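/- **Lemma 4 (Poisson brackets of the quantum variables).** Let $\hbar>0$, let $\mathcal H$ be a complex Hilbert space (inner product antilinear in the first entry), and let $\hat q^1,\dots,\hat q^N,\hat p_1,\dots,\hat p_N$ be symmetric operators on a common dense invariant domain $\mathcal D\subset\mathcal H$ with $[\hat q^i,\hat q^j]=[\hat p_i,\hat p_j]=0$ and $[\hat q^i,\hat p_j]=i\hbar\,\delta_{ij}$ on $\mathcal D$. Let $\Omega(\Phi,\Psi)=2\hbar\,\mathrm{Im}\langle\Phi,\Psi\rangle$. A vector $X_F(\Psi)\in\mathcal H$ is the Hamiltonian vector of $F:\mathcal D\to\mathbb R$ at $\Psi\in\mathcal D$ if $\frac{d}{dt}F(\Psi+t\eta)|_{t=0}$ exists and equals $\Omega(X_F(\Psi),\eta)$ for all $\eta\in\mathcal D$ (it is then unique), and $\{F,K\}(\Psi)=\Omega(X_F(\Psi),X_K(\Psi))$. For multi-indices $a,b\in\mathbb N_0^N$ let $$G^{a}_{b}(\Psi)=\Big\langle\Psi,\Big(\prod_i(\hat q^i-q^i)^{a_i}\prod_i(\hat p_i-p_i)^{b_i}\Big)_{\rm Weyl}\Psi\Big\rangle,\qquad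 q^i=\langle\Psi,\hat q^i\Psi\rangle,\quad p_i=\langle\Psi,\hat p_i\Psi\rangle,$$ where "Weyl" means that the product is averaged over all orders of its factors. Then for all $a,b,c,d\in\mathbb N_0^N$ and every $\Psi\in\mathcal D$ with $\|\Psi\|=1$, the Hamiltonian vectors of $G^a_b$ and $G^c_d$ at $\Psi$ exist, and at $\Psi$ $$\{G^a_b,G^c_d\}=-\sum_{r,s,e}(-1)^{r+s}\big(\tfrac{\hbar}{2}\big)^{2r}\,\delta_{e_1+\dots+e_N,\,2r+1}\,K_{r,s,e}^{a,b,c,d}\;G^{a+c-e}_{b+d-e}-\sum_{f=1}^N\Big(a_fd_f\,G^{a-1_f}_{b}\,G^{c}_{d-1_f}-b_fc_f\,G^{a}_{b-1_f}\,G^{c-1_f}_{d}\Big).$$ Here $1_f$ is the $f$-th unit multi-index (terms with a vanishing prefactor $a_fd_f$ or $b_fc_f$ are read as $0$), the sum is over integers $r,s$ and multi-indices $e\in\mathbb N_0^N$ with $1\le 2r+1\le\sum_f(\min(a_f,d_f)+\min(b_f,c_f))$, $0\le s\le\min(2r+1,\sum_f\min(a_f,d_f))$, $0\le e_f\le\min(a_f,d_f,s)+\min(b_f,c_f,2r+1-s)$,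 and $$K_{r,s,e}^{a,b,c,d}=\sum_{g\in\mathbb N_0^N}\delta_{g_1+\dots+g_N,\,2r+1-s}\prod_{f=1}^N g_f!\,(e_f-g_f)!\binom{a_f}{e_f-g_f}\binom{b_f}{g_f}\binom{c_f}{g_f}\binom{d_f}{e_f-g_f},$$ the sum being over $\max(e_f-s,e_f-a_f,e_f-d_f,0)\le g_f\le\min(b_f,c_f,2r+1-s,e_f)$. -/

import Mathlib

open scoped Nat

noncomputable section

/-- `N` canonical degrees of freedom on the Hilbert space `H`: position and momentum operators,
given as symmetric operators on a common dense invariant domain, which satisfy the canonical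
commutation relations there. -/
structure CanonicalOperators (N : ℕ) (hbar : ℝ) (H : Type*) [NormedAddCommGroup H]
    [InnerProductSpace ℂ H] [CompleteSpace H] where
  /-- the common domain -/
  domain : Submodule ℂ H
  dense_domain : Dense (domain : Set H)
  /-- position operators -/
  q : Fin N → Module.End ℂ domain
  /-- momentum operators -/
  p : Fin N → Module.End ℂ domain
  q_symmetric : ∀ i, (q i).IsSymmetric
  p_symmetric : ∀ i, (p i).IsSymmetric
  q_comm : ∀ i j, q i * q j - q j * q i = 0
  p_comm : ∀ i j, p i * p j - p j * p i = 0
  q_p_comm : ∀ i j, q i * p j - p j * q i =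
    if i = j then (Complex.I * (hbar : ℂ)) • (1 : Module.End ℂ domain) else 0

/-- The symplectic structure: `⟨Φ, Ψ⟩ = G(Φ, Ψ) / (2ħ) + i Ω(Φ, Ψ) / (2ħ)`. -/
def sympForm {H : Type*} [NormedAddCommGroup H] [InnerProductSpace ℂ H]
    (hbar : ℝ) (Φ Ψ : H) : ℝ :=
  2 * hbar * (inner ℂ Φ Ψ : ℂ).im

/-- `X` is the value at `Ψ` of the Hamiltonian vector field of the function `F`, which is defined
on the subspace `D`: for all `η ∈ D`, the derivative of `F` at `Ψ` along `η` exists and is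
`Ω(X, η)`. -/
def IsHamiltonianVector {H : Type*} [NormedAddCommGroup H] [InnerProductSpace ℂ H]
    (hbar : ℝ) {D : Submodule ℂ H} (F : D → ℝ) (Ψ : D) (X : H) : Prop :=
  ∀ η : D, HasDerivAt (fun t : ℝ => F (Ψ + (t : ℂ) • η)) (sympForm hbar X (η : H)) 0

/-- The functions `F` and `K` on `D` have Hamiltonian vectors `X_F`, `X_K` at `Ψ`, and their
Poisson bracket `{F, K} = Ω(X_F, X_K)` has the value `v` at `Ψ`. -/
def HasPoissonBracketAt {H : Type*} [NormedAddCommGroup H] [InnerProductSpace ℂ H]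
    (hbar : ℝ) {D : Submodule ℂ H} (F K : D → ℝ) (Ψ : D) (v : ℝ) : Prop :=
  ∃ X Y : H, IsHamiltonianVector hbar F Ψ X ∧ IsHamiltonianVector hbar K Ψ Y ∧
    sympForm hbar X Y = v

/-- On a dense domain a Hamiltonian vector is unique. -/
theorem IsHamiltonianVector.unique {H : Type*} [NormedAddCommGroup H] [InnerProductSpace ℂ H]
    {hbar : ℝ} (hh : 0 < hbar) {D : Submodule ℂ H} (hD : Dense (D : Set H)) {F : D → ℝ} {Ψ : D}
    {X Y : H} (hX : IsHamiltonianVector hbar F Ψ X) (hY : IsHamiltonianVector hbar F Ψ Y) :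
    X = Y := by
  have him : ∀ η : D, (inner ℂ (X - Y) (η : H) : ℂ).im = 0 := by
    intro η
    have h := (hX η).unique (hY η)
    unfold sympForm at h
    rw [inner_sub_left, Complex.sub_im]
    have := mul_left_cancel₀ (by positivity) h
    linarith
  refine sub_eq_zero.mp (hD.eq_zero_of_inner_left (𝕜 := ℂ) fun η hη => ?_)
  apply Complex.ext
  · have h := him (Complex.I • ⟨η, hη⟩)
    rw [Submodule.coe_smul, inner_smul_right] at h
    simpa using h
  · exact him ⟨η, hη⟩

/-- On a dense domain the value of the Poisson bracket is unique. -/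
theorem HasPoissonBracketAt.unique {H : Type*} [NormedAddCommGroup H] [InnerProductSpace ℂ H]
    {hbar : ℝ} (hh : 0 < hbar) {D : Submodule ℂ H} (hD : Dense (D : Set H)) {F K : D → ℝ} {Ψ : D}
    {v w : ℝ} (hv : HasPoissonBracketAt hbar F K Ψ v) (hw : HasPoissonBracketAt hbar F K Ψ w) :
    v = w := by
  obtain ⟨X, Y, hX, hY, rfl⟩ := hv
  obtain ⟨X', Y', hX', hY', rfl⟩ := hw
  rw [hX.unique hh hD hX', hY.unique hh hD hY']

/-- The totally symmetrized (Weyl-ordered) product of `n` operators: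
the average of their products over all `n!` orders. -/
def weylProd {V : Type*} [AddCommGroup V] [Module ℂ V] {n : ℕ} (A : Fin n → Module.End ℂ V) :
    Module.End ℂ V :=
  ((n ! : ℕ) : ℂ)⁻¹ • ∑ σ : Equiv.Perm (Fin n), (List.ofFn fun k => A (σ k)).prod

/-- The word with `a 1` letters `q¹`, …, `a N` letters `q^N`, `b 1` letters `p₁`, …,
`b N` letters `p_N`; `Sum.inl i` stands for `qⁱ` and `Sum.inr i` for `pᵢ`. -/
def momentWord {N : ℕ} (a b : Fin N → ℕ) : List (Fin N ⊕ Fin N) :=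
  (List.finRange N).flatMap (fun i => List.replicate (a i) (Sum.inl i)) ++
    (List.finRange N).flatMap (fun i => List.replicate (b i) (Sum.inr i))

namespace CanonicalOperators

variable {N : ℕ} {hbar : ℝ} {H : Type*} [NormedAddCommGroup H] [InnerProductSpace ℂ H]
  [CompleteSpace H] (S : CanonicalOperators N hbar H)

/-- All fundamental operators `x̂ = (q̂, p̂)`. -/
def x : Fin N ⊕ Fin N → Module.End ℂ S.domain :=
  Sum.elim S.q S.p

/-- The mean value `⟨Ψ, A Ψ⟩` (real if `A` is symmetric). -/
def mean (A : Module.End ℂ S.domain) (Ψ : S.domain) : ℝ :=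
  (inner ℂ Ψ (A Ψ) : ℂ).re

/-- The centered operator `x̂ⁱ - xⁱ`, where `xⁱ = ⟨Ψ, x̂ⁱ Ψ⟩`. -/
def centered (Ψ : S.domain) (i : Fin N ⊕ Fin N) : Module.End ℂ S.domain :=
  S.x i - ((S.mean (S.x i) Ψ : ℝ) : ℂ) • (1 : Module.End ℂ S.domain)

/-- The Weyl-ordered product of the operators `(q̂ⁱ - qⁱ)` with multiplicities `a i` and
`(p̂ᵢ - pᵢ)` with multiplicities `b i`. -/
def centeredMonomial (a b : Fin N → ℕ) (Ψ : S.domain) : Module.End ℂ S.domain :=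
  weylProd fun k => S.centered Ψ ((momentWord a b).get k)

/-- The quantum variable `G^a_b`, as a function of the state. -/
def G (a b : Fin N → ℕ) (Ψ : S.domain) : ℝ :=
  S.mean (S.centeredMonomial a b Ψ) Ψ

end CanonicalOperators

theorem inner_list_prod_symmetric {V : Type*} [SeminormedAddCommGroup V] [InnerProductSpace ℂ V]
    (l : List (Module.End ℂ V)) (hl : ∀ A ∈ l, A.IsSymmetric) (u v : V) :
    (inner ℂ (l.prod u) v : ℂ) = inner ℂ u (l.reverse.prod v) := by
  induction l generalizing u v with
  | nil => simp
  | cons A l ih =>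
    rw [List.prod_cons, List.reverse_cons, List.prod_append, Module.End.mul_apply,
      hl A (by simp), ih fun B hB => hl B (by simp [hB])]
    simp

theorem weylProd_isSymmetric {V : Type*} [SeminormedAddCommGroup V] [InnerProductSpace ℂ V]
    {n : ℕ} (A : Fin n → Module.End ℂ V) (hA : ∀ i, (A i).IsSymmetric) :
    (weylProd A).IsSymmetric := by
  intro u v
  unfold weylProd
  simp only [LinearMap.smul_apply, LinearMap.sum_apply, inner_smul_left, inner_smul_right,
    sum_inner, inner_sum, map_inv₀, Complex.conj_natCast]
  congr 1
  rw [← Equiv.sum_comp (Equiv.mulRight (Fin.revPerm : Equiv.Perm (Fin n)))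
    (fun σ : Equiv.Perm (Fin n) => (inner ℂ u ((List.ofFn fun k => A (σ k)).prod v) : ℂ))]
  refine Finset.sum_congr rfl fun σ _ => ?_
  rw [inner_list_prod_symmetric _ (by
    intro B hB
    obtain ⟨k, rfl⟩ := List.mem_ofFn.mp hB
    exact hA _)]
  congr 3
  apply List.ext_getElem
  · simp
  · intro i h1 h2
    simp only [List.length_reverse, List.length_ofFn] at h1
    simp only [List.getElem_reverse, List.getElem_ofFn, List.length_ofFn]
    change A (σ _) = A (σ (Fin.rev _))
    congr 2
    ext
    simp only [Fin.val_rev]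
    omega

/-- No information is lost by the real part in `G`: the mean value is real. -/
theorem CanonicalOperators.inner_centeredMonomial {N : ℕ} {hbar : ℝ} {H : Type*}
    [NormedAddCommGroup H] [InnerProductSpace ℂ H] [CompleteSpace H]
    (S : CanonicalOperators N hbar H) (a b : Fin N → ℕ) (Ψ : S.domain) :
    (inner ℂ Ψ (S.centeredMonomial a b Ψ Ψ) : ℂ) = (S.G a b Ψ : ℂ) := by
  have hx : ∀ i, (S.x i).IsSymmetric := by
    rintro (i | i)
    · exact S.q_symmetric i
    · exact S.p_symmetric i
  have hc : ∀ i, (S.centered Ψ i).IsSymmetric := by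
    intro i u v
    simp only [CanonicalOperators.centered, LinearMap.sub_apply, LinearMap.smul_apply,
      Module.End.one_apply, inner_sub_left, inner_sub_right, inner_smul_left, inner_smul_right,
      Complex.conj_ofReal, hx i u v]
  have h := weylProd_isSymmetric _ (fun k => hc ((momentWord a b).get k)) Ψ Ψ
  refine (Complex.conj_eq_iff_re.mp ?_).symm
  rw [inner_conj_symm]
  exact h

/-- The coefficient `K_{r,s,e}^{a,b,c,d}`. -/
def bracketCoeff {N : ℕ} (a b c d : Fin N → ℕ) (r s : ℕ) (e : Fin N → ℕ) : ℕ :=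
  ∑ g ∈ (Fintype.piFinset fun f =>
      Finset.Icc (max (e f - s) (max (e f - a f) (e f - d f)))
        (min (b f) (min (c f) (min (2 * r + 1 - s) (e f))))) with
      ∑ f, g f = 2 * r + 1 - s,
    ∏ f, (g f)! * (e f - g f)! *
      ((a f).choose (e f - g f) * (b f).choose (g f) * (c f).choose (g f) *
        (d f).choose (e f - g f))

end

noncomputable section

/-! Write `W m` for the Weyl-ordered monomial with exponent `m` in the centered operators, `e_i` for
a unit exponent, `τ` for the exchange of `qⁱ` and `pᵢ`, and `2 c_i` for the value of `[x_i, x_{τ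
i}]`.

A moment depends on the state through the two vectors in the mean value and through the centering.
Shifting `x_i` by a number differentiates `W m` to `-m_i W (m - e_i)`, so the Hamiltonian vector is
`-(i/ħ) A_m Ψ` with the symmetric operator `A_m = W m - ∑ i, m_i ⟨W (m - e_i)⟩ x_i`
(`isHamiltonianVector_moment`). The bracket is therefore `⟨[A_m, A_n]⟩ / (iħ)`
(`sympForm_momentGenerator`).

In this commutator the two cross terms and the linear-linear term are the same sum up to sign, and
they leave one copy of it: the products of two moments (`map_commutator_sub_sum`). The rest, `[W m,
W n]`, is the Moyal bracket: `W m * W n` is the sum over all contractions of letters `x_j` on the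
left with letters `x_{τ j}` on the right, and exchanging the factors changes the sign of exactly the
odd contraction patterns (`mul_eq_sum`, `commutator_eq_sum`). Sorting the odd patterns by `r`, `s`,
`e` and `g` produces the coefficients `K` (`sum_odd_contractions`).

The algebra rests on one recursion, `|m| W m = ∑ i, m_i x_i W (m - e_i)`, obtained by splitting off
the first letter. -/

/-! ### Weyl-ordered products and their recursion. -/

theorem weylProd_comp_equiv {V : Type*} [AddCommGroup V] [Module ℂ V] {n n' : ℕ}
    (A : Fin n → Module.End ℂ V) (e : Fin n' ≃ Fin n) :
    weylProd (fun k => A (e k)) = weylProd A := by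
  obtain rfl : n' = n := by simpa using Fintype.card_congr e
  unfold weylProd
  congr 1
  exact Equiv.sum_comp (Equiv.mulLeft e)
    (fun σ : Equiv.Perm (Fin n') => (List.ofFn fun k => A (σ k)).prod)

theorem count_map_univ {α σ : Type*} [Fintype α] [DecidableEq σ] (f : α → σ) (i : σ) :
    Multiset.count i (Finset.univ.val.map f) = Fintype.card {k // f k = i} := by
  rw [Multiset.count_map, Fintype.card_subtype, Finset.card_def, Finset.filter_val]
  simp only [eq_comm]

/-- Words with the same letters have fibres of equal size over each letter; bijections of these
fibres glue to a permutation of positions, which the average absorbs. -/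
theorem weylProd_eq_of_map_eq {V σ : Type*} [AddCommGroup V] [Module ℂ V]
    (X : σ → Module.End ℂ V) {n n' : ℕ} (f : Fin n → σ) (g : Fin n' → σ)
    (h : (Finset.univ.val.map f : Multiset σ) = Finset.univ.val.map g) :
    weylProd (fun k => X (f k)) = weylProd (fun k => X (g k)) := by
  obtain rfl : n = n' := by simpa using congrArg Multiset.card h
  classical
  have e : ∀ i, {k // f k = i} ≃ {k // g k = i} := fun i =>
    Fintype.equivOfCardEq (by
      have hi := congrArg (Multiset.count i) h
      rw [count_map_univ, count_map_univ] at hi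
      convert hi)
  rw [← weylProd_comp_equiv (fun k => X (g k)) (Equiv.ofFiberEquiv e)]
  simp only [Equiv.ofFiberEquiv_map]

theorem weylProd_zero {V : Type*} [AddCommGroup V] [Module ℂ V] (A : Fin 0 → Module.End ℂ V) :
    weylProd A = 1 := by
  simp [weylProd]

/-- Splitting off the first factor of a Weyl-ordered product. -/
theorem succ_smul_weylProd {V : Type*} [AddCommGroup V] [Module ℂ V] {n : ℕ}
    (A : Fin (n + 1) → Module.End ℂ V) :
    ((n + 1 : ℕ) : ℂ) • weylProd A =
      ∑ i, A i * weylProd (fun k : Fin n => A (Equiv.swap 0 i k.succ)) := by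
  unfold weylProd
  -- A permutation of `Fin (n + 1)` is the choice of the image `i` of `0` together with a
  -- permutation of the remaining `n` positions.
  rw [Finset.univ_perm_fin_succ, Finset.sum_map, Fintype.sum_prod_type, smul_smul,
    Finset.smul_sum]
  refine Finset.sum_congr rfl fun i _ => ?_
  rw [mul_smul_comm, Finset.mul_sum]
  have hn : ((n + 1 : ℕ) : ℂ) ≠ 0 := Nat.cast_ne_zero.mpr n.succ_ne_zero
  congr 1
  · rw [Nat.factorial_succ, Nat.cast_mul, mul_inv, mul_inv_cancel_left₀ hn]
  · refine Finset.sum_congr rfl fun e _ => ?_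
    simp [List.ofFn_succ]

/-- The Weyl-ordered monomial `x^m` in the operators `X i`. -/
def weylMonomial {V σ : Type*} [AddCommGroup V] [Module ℂ V] (X : σ → Module.End ℂ V)
    (m : σ →₀ ℕ) : Module.End ℂ V :=
  weylProd fun k => X ((Finsupp.toMultiset m).toList.get k)

theorem weylProd_eq_weylMonomial {V σ : Type*} [AddCommGroup V] [Module ℂ V]
    (X : σ → Module.End ℂ V) (m : σ →₀ ℕ) {n : ℕ} (f : Fin n → σ)
    (hf : (Finset.univ.val.map f : Multiset σ) = Finsupp.toMultiset m) :
    weylProd (fun k => X (f k)) = weylMonomial X m := by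
  refine weylProd_eq_of_map_eq X f _ ?_
  rw [hf, Fin.univ_val_map, List.ofFn_get, Multiset.coe_toList]

theorem weylMonomial_zero {V σ : Type*} [AddCommGroup V] [Module ℂ V]
    (X : σ → Module.End ℂ V) : weylMonomial X 0 = 1 := by
  rw [← weylProd_eq_weylMonomial X 0 (n := 0) Fin.elim0 (by simp), weylProd_zero]

theorem degree_smul_weylMonomial {V σ : Type*} [AddCommGroup V] [Module ℂ V] [Fintype σ]
    [DecidableEq σ] (X : σ → Module.End ℂ V) (m : σ →₀ ℕ) :
    (m.degree : ℂ) • weylMonomial X m =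
      ∑ i, (m i : ℂ) • (X i * weylMonomial X (m - Finsupp.single i 1)) := by
  obtain ⟨n, f, hf⟩ : ∃ n, ∃ f : Fin n → σ,
      (Finset.univ.val.map f : Multiset σ) = Finsupp.toMultiset m :=
    ⟨_, (Finsupp.toMultiset m).toList.get, by
      rw [Fin.univ_val_map, List.ofFn_get, Multiset.coe_toList]⟩
  have hn : n = m.degree := by
    have := congrArg Multiset.card hf
    rw [Finsupp.card_toMultiset] at this
    simpa [Finsupp.degree_apply, Finsupp.sum] using this
  have hsum : ∀ F : σ → Module.End ℂ V, ∑ k, F (f k) = ∑ i, (m i : ℂ) • F i := by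
    intro F
    rw [← Finset.sum_fiberwise Finset.univ f]
    refine Finset.sum_congr rfl fun i _ => ?_
    rw [Finset.sum_congr rfl (g := fun _ => F i) (by simp +contextual), Finset.sum_const,
      ← Finsupp.count_toMultiset, ← hf, count_map_univ, Fintype.card_subtype, Nat.cast_smul_eq_nsmul]
  rw [← weylProd_eq_weylMonomial X m f hf, ← hn]
  rw [← hsum fun i => X i * weylMonomial X (m - Finsupp.single i 1)]
  cases n with
  | zero => simp
  | succ n =>
    rw [succ_smul_weylProd (fun k => X (f k))]
    refine Finset.sum_congr rfl fun i _ => ?_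
    congr 1
    refine weylProd_eq_weylMonomial X _ (fun k => f (Equiv.swap 0 i k.succ)) ?_
    -- The swap brings letter `f i` to the front, so the tail has the letters of `m` with one `f i`
    -- removed.
    have h1 : (Finset.univ.val.map (fun k => f (Equiv.swap 0 i k)) : Multiset σ) =
        Finsupp.toMultiset m := by
      rw [← hf, Fin.univ_val_map, Fin.univ_val_map, Multiset.coe_eq_coe]
      exact (Equiv.swap 0 i).ofFn_comp_perm f
    rw [Fin.univ_val_map, List.ofFn_succ, Equiv.swap_apply_left, ← Multiset.cons_coe,
      ← Fin.univ_val_map] at h1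
    apply (Multiset.cons_inj_right (f i)).mp
    rw [h1, ← Multiset.singleton_add, ← one_nsmul {f i},
      ← Finsupp.toMultiset_single, ← map_add, add_tsub_cancel_of_le]
    rw [Finsupp.single_le_iff]
    have : f i ∈ Finsupp.toMultiset m := by rw [← h1]; simp
    rw [Finsupp.mem_toMultiset, Finsupp.mem_support_iff] at this
    omega

/-! ### Commutation relations that follow from the recursion. -/

theorem degree_sub_single {σ : Type*} {m : σ →₀ ℕ} {i : σ} (hi : m i ≠ 0) :
    (m - Finsupp.single i 1).degree + 1 = m.degree := by
  conv_rhs => rw [← tsub_add_cancel_of_le (Finsupp.single_le_iff.mpr (Nat.one_le_iff_ne_zero.mpr hi)),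
    map_add, Finsupp.degree_single]

/-- Both sides count the ordered pairs of distinct factors of `x^m`, one equal to `x_i` and the
other to `x_j`. -/
theorem mul_sub_single_apply_comm {σ : Type*} (m : σ →₀ ℕ) (i j : σ) :
    m j * (m - Finsupp.single j 1 : σ →₀ ℕ) i = m i * (m - Finsupp.single i 1 : σ →₀ ℕ) j := by
  classical
  by_cases h : i = j
  · subst h; rfl
  · simp [h, Ne.symm h, mul_comm]

/-- The operators `W m` satisfy the recursion of the Weyl-ordered monomials in the `X i`. -/
structure IsWeylFamily {σ E : Type*} [Fintype σ] [Ring E] [Algebra ℂ E] (X : σ → E)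
    (W : (σ →₀ ℕ) → E) : Prop where
  map_zero : W 0 = 1
  degree_smul : ∀ m : σ →₀ ℕ,
    (m.degree : ℂ) • W m = ∑ i, (m i : ℂ) • (X i * W (m - Finsupp.single i 1))

namespace IsWeylFamily

variable {σ E : Type*} [Fintype σ] [Ring E] [Algebra ℂ E] {X : σ → E}
  {W : (σ →₀ ℕ) → E}

/-- By the symmetry of the pair count, `m_i` comes out of the sum, and what remains is the recursion
at `m - e_i`. -/
theorem sum_mul_sub_single (hW : IsWeylFamily X W) (m : σ →₀ ℕ) (i : σ) :
    ∑ j, ((m j : ℂ) * ((m - Finsupp.single j 1 : σ →₀ ℕ) i : ℕ)) •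
        (X j * W (m - Finsupp.single j 1 - Finsupp.single i 1)) =
      ((m i : ℂ) * ((m.degree : ℂ) - 1)) • W (m - Finsupp.single i 1) := by
  by_cases hi : m i = 0
  · rw [hi, Nat.cast_zero, zero_mul, zero_smul]
    refine Finset.sum_eq_zero fun j _ => ?_
    rw [← Nat.cast_mul, mul_sub_single_apply_comm, hi]
    simp
  · rw [← degree_sub_single hi, Nat.cast_succ, add_sub_cancel_right, mul_smul, hW.degree_smul,
      Finset.smul_sum]
    refine Finset.sum_congr rfl fun j _ => ?_
    rw [← Nat.cast_mul, mul_sub_single_apply_comm, Nat.cast_mul, mul_smul, tsub_right_comm]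

variable [DecidableEq σ] {τ : σ → σ} {c : σ → ℂ}

/-- The commutator with `X i` is a derivation. Applied to the recursion, it either hits the
split-off letter, which gives one copy of the result, or the remaining monomial, which gives `|m| -
1` copies by induction. -/
theorem commutator (hW : IsWeylFamily X W)
    (hX : ∀ i j, X i * X j - X j * X i = if j = τ i then algebraMap ℂ E (2 * c i) else 0)
    (i : σ) (m : σ →₀ ℕ) :
    X i * W m - W m * X i = (2 * c i * (m (τ i) : ℂ)) • W (m - Finsupp.single (τ i) 1) := by
  induction hn : m.degree generalizing m with
  | zero =>
    obtain rfl : m = 0 := by rwa [Finsupp.degree_eq_zero_iff] at hn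
    simp [hW.map_zero]
  | succ n ih =>
    have hn0 : (m.degree : ℂ) ≠ 0 := by rw [hn]; exact Nat.cast_ne_zero.mpr n.succ_ne_zero
    refine (IsUnit.mk0 _ hn0).smul_left_cancel.mp ?_
    rw [smul_sub, ← mul_smul_comm, ← smul_mul_assoc, hW.degree_smul, Finset.mul_sum,
      Finset.sum_mul, ← Finset.sum_sub_distrib]
    have key : ∀ j, X i * (m j : ℂ) • (X j * W (m - Finsupp.single j 1)) -
          (m j : ℂ) • (X j * W (m - Finsupp.single j 1)) * X i =
        (if j = τ i then (2 * c i * m j) • W (m - Finsupp.single j 1) else 0) +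
        (2 * c i) • (((m j : ℂ) * ((m - Finsupp.single j 1 : σ →₀ ℕ) (τ i) : ℕ)) •
          (X j * W (m - Finsupp.single j 1 - Finsupp.single (τ i) 1))) := by
      intro j
      by_cases hj : m j = 0
      · simp [hj]
      have h := ih (m - Finsupp.single j 1) (by have := degree_sub_single hj; omega)
      have e : X i * (X j * W (m - Finsupp.single j 1)) - X j * W (m - Finsupp.single j 1) * X i
          = (X i * X j - X j * X i) * W (m - Finsupp.single j 1) +
            X j * (X i * W (m - Finsupp.single j 1) - W (m - Finsupp.single j 1) * X i) := by
        noncomm_ring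
      rw [mul_smul_comm, smul_mul_assoc, ← smul_sub, e, hX, h, smul_add]
      congr 1
      · split_ifs
        · rw [← Algebra.smul_def, smul_smul, mul_comm]
        · simp
      · rw [mul_smul_comm, smul_smul, smul_smul]
        congr 1
        ring
    rw [Finset.sum_congr rfl fun j _ => key j, Finset.sum_add_distrib, ← Finset.smul_sum,
      hW.sum_mul_sub_single, Finset.sum_ite_eq' , if_pos (Finset.mem_univ _), smul_smul, ← add_smul,
      smul_smul]
    congr 1
    ring

/-- Half of the commutator: `W (m + e_i)` is the mean of `X i * W m` and `W m * X i`. The proof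
expands the recursion at `m + e_i`. -/
theorem mul_left (hW : IsWeylFamily X W)
    (hX : ∀ i j, X i * X j - X j * X i = if j = τ i then algebraMap ℂ E (2 * c i) else 0)
    (i : σ) (m : σ →₀ ℕ) :
    X i * W m = W (m + Finsupp.single i 1) +
      (c i * (m (τ i) : ℂ)) • W (m - Finsupp.single (τ i) 1) := by
  induction hn : m.degree using Nat.strong_induction_on generalizing m with
  | _ n ih =>
    have hd : ((m + Finsupp.single i 1).degree : ℂ) = m.degree + 1 := by
      rw [map_add, Finsupp.degree_single, Nat.cast_succ]
    have hd0 : ((m.degree : ℂ) + 1) ≠ 0 := Nat.cast_add_one_ne_zero _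
    have h1 := hW.degree_smul (m + Finsupp.single i 1)
    -- Induction rewrites `W (m - e_j + e_i)`, and `X i` is then moved to the left of `X j`. Summed
    -- over `j`, the lowered monomial gets `c_i m_{τ i}` times `2 + (|m| - 1)`, which matches the
    -- `|m| + 1` copies of `X i * W m`.
    have key : ∀ j, (((m + Finsupp.single i 1 : σ →₀ ℕ) j : ℕ) : ℂ) •
          (X j * W (m + Finsupp.single i 1 - Finsupp.single j 1)) =
        (if j = i then X j * W m else 0) + X i * (m j : ℂ) • (X j * W (m - Finsupp.single j 1)) -
        (if j = τ i then (2 * c i * m j) • W (m - Finsupp.single j 1) else 0) -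
        c i • (((m j : ℂ) * ((m - Finsupp.single j 1 : σ →₀ ℕ) (τ i) : ℕ)) •
          (X j * W (m - Finsupp.single j 1 - Finsupp.single (τ i) 1))) := by
      intro j
      have e1 : (((m + Finsupp.single i 1 : σ →₀ ℕ) j : ℕ) : ℂ) •
          (X j * W (m + Finsupp.single i 1 - Finsupp.single j 1)) =
          (if j = i then X j * W m else 0) +
          (m j : ℂ) • (X j * W (m + Finsupp.single i 1 - Finsupp.single j 1)) := by
        by_cases h : j = i
        · subst h
          simp [add_smul, add_comm]
        · simp [h]
      rw [e1]
      by_cases hj : m j = 0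
      · simp [hj]
      have hle : Finsupp.single j 1 ≤ m :=
        Finsupp.single_le_iff.mpr (Nat.one_le_iff_ne_zero.mpr hj)
      have h := ih _ (by rw [← hn, ← degree_sub_single hj]; exact Nat.lt_succ_self _)
        (m - Finsupp.single j 1) rfl
      rw [add_sub_assoc, add_sub_assoc, ← tsub_add_eq_add_tsub hle, eq_sub_of_add_eq h.symm]
      congr 1
      have hX' : X j * X i = X i * X j - (X i * X j - X j * X i) := by abel
      rw [mul_sub, ← mul_assoc, hX', hX, smul_sub, sub_mul, smul_sub, mul_smul_comm, mul_smul_comm,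
        mul_assoc]
      congr 1
      · congr 1
        split_ifs
        · rw [← Algebra.smul_def, smul_smul, mul_comm]
        · simp
      · rw [smul_smul, smul_smul]
        congr 1
        ring
    rw [Finset.sum_congr rfl fun j _ => key j, Finset.sum_sub_distrib, Finset.sum_sub_distrib,
      Finset.sum_add_distrib, ← Finset.smul_sum, ← Finset.mul_sum, ← hW.degree_smul,
      hW.sum_mul_sub_single, Finset.sum_ite_eq', Finset.sum_ite_eq', if_pos (Finset.mem_univ _),
      if_pos (Finset.mem_univ _), hd, mul_smul_comm] at h1
    refine (IsUnit.mk0 _ hd0).smul_left_cancel.mp ?_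
    rw [smul_add, h1]
    module

end IsWeylFamily

/-! ### The Moyal product of commutative monomials. -/

/-- The sum of all partial contractions of `x ^ m` with `y ^ n`, each contraction of a factor `x`
with a factor `y` contributing `c`. -/
def contractPow {R : Type*} [CommRing R] (c x y : R) (m n : ℕ) : R :=
  ∑ k ∈ Finset.range (min m n + 1),
    c ^ k * ((k ! * m.choose k * n.choose k : ℕ) : R) * (x ^ (m - k) * y ^ (n - k))

section contractPow

variable {R : Type*} [CommRing R] (c x y : R)

theorem contractPow_comm (m n : ℕ) : contractPow c x y m n = contractPow c y x n m := by
  unfold contractPow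
  rw [min_comm]
  refine Finset.sum_congr rfl fun k _ => ?_
  push_cast
  ring

theorem contractPow_eq_sum_range {m n M : ℕ} (hM : min m n < M) :
    contractPow c x y m n = ∑ k ∈ Finset.range M,
      c ^ k * ((k ! * m.choose k * n.choose k : ℕ) : R) * (x ^ (m - k) * y ^ (n - k)) := by
  refine Finset.sum_subset (Finset.range_mono hM) fun k _ hk => ?_
  have : m < k ∨ n < k := by
    rw [Finset.mem_range] at hk
    omega
  rcases this with h | h <;> simp [Nat.choose_eq_zero_of_lt h]

theorem contractPow_zero_left (n : ℕ) : contractPow c x y 0 n = y ^ n := by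
  simp [contractPow]

/-- The additional factor `x` either stays uncontracted or is contracted with one of the `n` factors
`y`. -/
theorem contractPow_succ_left (m n : ℕ) :
    contractPow c x y (m + 1) n =
      x * contractPow c x y m n + c * n * contractPow c x y m (n - 1) := by
  rw [contractPow_eq_sum_range c x y (M := m + 2) (by omega),
    contractPow_eq_sum_range c x y (m := m) (n := n) (M := m + 2) (by omega),
    contractPow_eq_sum_range c x y (m := m) (n := n - 1) (M := m + 1) (by omega),
    Finset.sum_range_succ' _ (m + 1), Finset.sum_range_succ' _ (m + 1), mul_add, Finset.mul_sum,
    Finset.mul_sum, add_right_comm, ← Finset.sum_add_distrib]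
  congr 1
  · refine Finset.sum_congr rfl fun k _ => ?_
    have h1 : (k + 1) * n.choose (k + 1) = n * (n - 1).choose k := by
      cases n with
      | zero => simp
      | succ n => rw [Nat.add_sub_cancel, Nat.add_one_mul_choose_eq, mul_comm]
    have h2 : (x : R) ^ (m - k) * (m.choose (k + 1) : ℕ) =
        x * x ^ (m - (k + 1)) * (m.choose (k + 1) : ℕ) := by
      by_cases h : k + 1 ≤ m
      · rw [← pow_succ', show m - (k + 1) + 1 = m - k by omega]
      · simp [Nat.choose_eq_zero_of_lt (not_le.mp h)]
    have h3 : ((k + 1)! * (m + 1).choose (k + 1) * n.choose (k + 1) : ℕ) =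
        (k + 1)! * m.choose (k + 1) * n.choose (k + 1) +
          n * (k ! * m.choose k * (n - 1).choose k) := by
      rw [Nat.choose_succ_succ', Nat.factorial_succ]
      linear_combination k ! * m.choose k * h1
    rw [h3, Nat.add_sub_add_right, show n - 1 - k = n - (k + 1) by omega]
    push_cast
    linear_combination c ^ (k + 1) * ((k + 1)! : ℕ) * (n.choose (k + 1) : ℕ) * y ^ (n - (k + 1)) * h2
  · simp [pow_succ', mul_assoc]

theorem contractPow_succ_right (m n : ℕ) :
    contractPow c x y m (n + 1) =
      y * contractPow c x y m n + c * m * contractPow c x y (m - 1) n := by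
  rw [contractPow_comm, contractPow_succ_left, contractPow_comm c y x n m,
    contractPow_comm c y x n (m - 1)]

end contractPow

section moyalMonomial

open MvPolynomial

variable {σ : Type*} [Fintype σ]

/-- The Moyal product of the monomials `x^m` and `x^n`, where `x i` is conjugate to `x (τ i)` and
`[x i, x (τ i)] = 2 * c i`. -/
def moyalMonomial (τ : σ → σ) (c : σ → ℂ) (m n : σ →₀ ℕ) : MvPolynomial σ ℂ :=
  ∏ j, contractPow (C (c j)) (X j) (X (τ j)) (m j) (n (τ j))

variable {τ : σ → σ} {c : σ → ℂ}

theorem moyalMonomial_zero_left (hτ : Function.Involutive τ) (n : σ →₀ ℕ) :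
    moyalMonomial τ c 0 n = monomial n 1 := by
  simp only [moyalMonomial, Finsupp.coe_zero, Pi.zero_apply, contractPow_zero_left]
  rw [hτ.bijective.prod_comp (fun j => (X j : MvPolynomial σ ℂ) ^ n j), monomial_eq,
    Finsupp.prod_fintype _ _ (by simp)]
  simp

variable [DecidableEq σ]

theorem moyalMonomial_add_single_left (hτ : Function.Involutive τ) (m n : σ →₀ ℕ)
    (i : σ) :
    moyalMonomial τ c (m + Finsupp.single i 1) n = X i * moyalMonomial τ c m n +
      (c i * (n (τ i) : ℂ)) • moyalMonomial τ c m (n - Finsupp.single (τ i) 1) := by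
  simp only [moyalMonomial]
  rw [← Finset.mul_prod_erase _ _ (Finset.mem_univ i), ← Finset.mul_prod_erase _ _ (Finset.mem_univ i),
    ← Finset.mul_prod_erase _ _ (Finset.mem_univ i)]
  have h1 : ∀ j ∈ Finset.univ.erase i, (m + Finsupp.single i 1 : σ →₀ ℕ) j = m j := by
    intro j hj
    simp [Finset.ne_of_mem_erase hj]
  have h2 : ∀ j ∈ Finset.univ.erase i, (n - Finsupp.single (τ i) 1 : σ →₀ ℕ) (τ j) = n (τ j) := by
    intro j hj
    simp [hτ.injective.ne (Finset.ne_of_mem_erase hj)]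
  rw [Finset.prod_congr rfl fun j hj => by rw [h1 j hj],
    Finset.prod_congr (s₁ := Finset.univ.erase i) rfl
      (fun j hj => by rw [h2 j hj] : ∀ j ∈ Finset.univ.erase i,
        contractPow (C (c j)) (X j) (X (τ j)) (m j) ((n - Finsupp.single (τ i) 1 : σ →₀ ℕ) (τ j)) =
        contractPow (C (c j)) (X j) (X (τ j)) (m j) (n (τ j)))]
  simp only [Finsupp.add_apply, Finsupp.single_eq_same, contractPow_succ_left,
    Finsupp.tsub_apply, smul_eq_C_mul, C_mul, map_natCast]
  ring

/-- The coefficient is `c (τ i)`, since a letter `x_i` on the right is contracted with `x_{τ i}` on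
the left. -/
theorem moyalMonomial_add_single_right (hτ : Function.Involutive τ) (m n : σ →₀ ℕ)
    (i : σ) :
    moyalMonomial τ c m (n + Finsupp.single i 1) = X i * moyalMonomial τ c m n +
      (c (τ i) * (m (τ i) : ℂ)) • moyalMonomial τ c (m - Finsupp.single (τ i) 1) n := by
  simp only [moyalMonomial]
  rw [← Finset.mul_prod_erase _ _ (Finset.mem_univ (τ i)),
    ← Finset.mul_prod_erase _ _ (Finset.mem_univ (τ i)),
    ← Finset.mul_prod_erase _ _ (Finset.mem_univ (τ i))]
  have h1 : ∀ j ∈ Finset.univ.erase (τ i), (n + Finsupp.single i 1 : σ →₀ ℕ) (τ j) = n (τ j) := by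
    intro j hj
    have : i ≠ τ j := fun h => Finset.ne_of_mem_erase hj (by rw [h, hτ])
    simp [this]
  have h2 : ∀ j ∈ Finset.univ.erase (τ i), (m - Finsupp.single (τ i) 1 : σ →₀ ℕ) j = m j := by
    intro j hj
    simp [Finset.ne_of_mem_erase hj]
  rw [Finset.prod_congr rfl fun j hj => by rw [h1 j hj],
    Finset.prod_congr (s₁ := Finset.univ.erase (τ i)) rfl
      (fun j hj => by rw [h2 j hj] : ∀ j ∈ Finset.univ.erase (τ i),
        contractPow (C (c j)) (X j) (X (τ j)) ((m - Finsupp.single (τ i) 1 : σ →₀ ℕ) j) (n (τ j)) =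
        contractPow (C (c j)) (X j) (X (τ j)) (m j) (n (τ j)))]
  simp only [Finsupp.add_apply, Finsupp.single_eq_same, contractPow_succ_right, hτ i,
    Finsupp.tsub_apply, smul_eq_C_mul, C_mul, map_natCast]
  ring

/-- The coefficient of the contraction pattern `k` in the Moyal product of `x^m` and `x^n`. -/
def moyalCoeff {σ : Type*} [Fintype σ] (τ : σ → σ) (m n : σ → ℕ) (k : σ → ℕ) : ℕ :=
  ∏ j, (k j)! * (m j).choose (k j) * (n (τ j)).choose (k j)

/-- The exponent which is left of `x^m * x^n` by the contraction pattern `k`. -/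
def moyalExponent {σ : Type*} [Fintype σ] (τ : σ → σ) (m n : σ → ℕ) (k : σ → ℕ) : σ →₀ ℕ :=
  Finsupp.equivFunOnFinite.symm fun j => m j - k j + (n j - k (τ j))

theorem moyalMonomial_eq_sum (hτ : Function.Involutive τ) (m n : σ →₀ ℕ) :
    moyalMonomial τ c m n =
      ∑ k ∈ Fintype.piFinset fun j => Finset.range (min (m j) (n (τ j)) + 1),
        ((∏ j, c j ^ k j) * (moyalCoeff τ m n k : ℂ)) • monomial (moyalExponent τ m n k) (1 : ℂ) := by
  simp only [moyalMonomial, contractPow]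
  rw [Finset.prod_univ_sum]
  refine Finset.sum_congr rfl fun k _ => ?_
  rw [Finset.prod_mul_distrib, Finset.prod_mul_distrib, Finset.prod_mul_distrib, smul_eq_C_mul,
    C_mul, map_prod, map_natCast, moyalCoeff, Nat.cast_prod]
  simp only [map_pow]
  congr 1
  rw [← hτ.bijective.prod_comp (fun j => (X (τ j) : MvPolynomial σ ℂ) ^ (n (τ j) - k j)),
    ← Finset.prod_mul_distrib, monomial_eq, Finsupp.prod_fintype _ _ (by simp), C_1, one_mul]
  refine Finset.prod_congr rfl fun j _ => ?_
  rw [hτ j, ← pow_add]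
  rfl

end moyalMonomial

/-! ### The product and the commutator of Weyl-ordered monomials. -/

namespace IsWeylFamily

variable {σ E : Type*} [Fintype σ] [DecidableEq σ] [Ring E] [Algebra ℂ E] {X : σ → E}
  {W : (σ →₀ ℕ) → E} {τ : σ → σ} {c : σ → ℂ}

/-- Weyl-ordered monomials multiply by the Moyal product. -/
theorem mul_eq_constr_moyalMonomial (hW : IsWeylFamily X W)
    (hX : ∀ i j, X i * X j - X j * X i = if j = τ i then algebraMap ℂ E (2 * c i) else 0)
    (hτ : Function.Involutive τ) (hc : ∀ i, c (τ i) = -c i) (m n : σ →₀ ℕ) :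
    W m * W n = (MvPolynomial.basisMonomials σ ℂ).constr ℂ W (moyalMonomial τ c m n) := by
  set T := (MvPolynomial.basisMonomials σ ℂ).constr ℂ W with hT
  have hTm : ∀ n, T (MvPolynomial.monomial n 1) = W n := by
    intro n
    have := (MvPolynomial.basisMonomials σ ℂ).constr_basis ℂ W n
    rwa [MvPolynomial.coe_basisMonomials] at this
  induction hd : m.degree using Nat.strong_induction_on generalizing m n with
  | _ d ih =>
    by_cases hm : m = 0
    · rw [hm, moyalMonomial_zero_left hτ, hTm, hW.map_zero, one_mul]
    obtain ⟨i, hi⟩ := Finsupp.ne_iff.mp hm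
    rw [Finsupp.coe_zero, Pi.zero_apply] at hi
    obtain ⟨m, rfl⟩ : ∃ m', m = m' + Finsupp.single i 1 :=
      ⟨m - Finsupp.single i 1, (tsub_add_cancel_of_le
        (Finsupp.single_le_iff.mpr (Nat.one_le_iff_ne_zero.mpr hi))).symm⟩
    have hdm : m.degree < d := by
      rw [← hd, map_add, Finsupp.degree_single]
      exact Nat.lt_succ_self _
    have hdm' : (m - Finsupp.single (τ i) 1).degree < d := by
      refine lt_of_le_of_lt ?_ hdm
      exact Finsupp.degree_mono tsub_le_self
    -- Right multiplication by `X i` has the opposite correction: subtract `commutator` from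
    -- `mul_left`.
    have e1 : W (m + Finsupp.single i 1) = W m * X i +
        (c i * (m (τ i) : ℂ)) • W (m - Finsupp.single (τ i) 1) := by
      have h1 := hW.mul_left hX i m
      have h2 := hW.commutator hX i m
      rw [sub_eq_iff_eq_add] at h2
      rw [h1, ← sub_eq_iff_eq_add] at h2
      rw [← sub_eq_zero] at h2 ⊢
      rw [← h2]
      module
    rw [e1, add_mul, mul_assoc, hW.mul_left hX i n, mul_add, smul_mul_assoc, mul_smul_comm,
      ih _ hdm m _ rfl, ih _ hdm m _ rfl, ih _ hdm' _ _ rfl, moyalMonomial_add_single_left hτ,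
      moyalMonomial_add_single_right hτ, hc, ← map_smul, ← map_smul, ← map_add, ← map_add]
    -- As `c (τ i) = -c i`, the term which lowers `m` in the right recursion cancels the one from
    -- `e1`; the left recursion remains.
    refine congrArg T ?_
    rw [neg_mul, neg_smul]
    abel

theorem mul_eq_sum (hW : IsWeylFamily X W)
    (hX : ∀ i j, X i * X j - X j * X i = if j = τ i then algebraMap ℂ E (2 * c i) else 0)
    (hτ : Function.Involutive τ) (hc : ∀ i, c (τ i) = -c i) (m n : σ →₀ ℕ) :
    W m * W n = ∑ k ∈ Fintype.piFinset fun j => Finset.range (min (m j) (n (τ j)) + 1),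
      ((∏ j, c j ^ k j) * (moyalCoeff τ m n k : ℂ)) • W (moyalExponent τ m n k) := by
  rw [hW.mul_eq_constr_moyalMonomial hX hτ hc, moyalMonomial_eq_sum hτ, map_sum]
  refine Finset.sum_congr rfl fun k _ => ?_
  rw [map_smul]
  congr 1
  have := (MvPolynomial.basisMonomials σ ℂ).constr_basis ℂ W (moyalExponent τ m n k)
  rwa [MvPolynomial.coe_basisMonomials] at this

/-- The commutator of Weyl-ordered monomials is the Moyal bracket. -/
theorem commutator_eq_sum (hW : IsWeylFamily X W)
    (hX : ∀ i j, X i * X j - X j * X i = if j = τ i then algebraMap ℂ E (2 * c i) else 0)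
    (hτ : Function.Involutive τ) (hc : ∀ i, c (τ i) = -c i) (m n : σ →₀ ℕ) :
    W m * W n - W n * W m =
      ∑ k ∈ Fintype.piFinset fun j => Finset.range (min (m j) (n (τ j)) + 1),
        ((1 - (-1) ^ (∑ j, k j)) * ((∏ j, c j ^ k j) * (moyalCoeff τ m n k : ℂ))) •
          W (moyalExponent τ m n k) := by
  have h : W n * W m = ∑ k ∈ Fintype.piFinset fun j => Finset.range (min (m j) (n (τ j)) + 1),
      ((-1) ^ (∑ j, k j) * ((∏ j, c j ^ k j) * (moyalCoeff τ m n k : ℂ))) •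
        W (moyalExponent τ m n k) := by
    rw [hW.mul_eq_sum hX hτ hc n m]
    -- Composition with `τ` turns a contraction pattern of `n` with `m` into one of `m` with `n`;
    -- each contraction then contributes a sign, as `c ∘ τ = -c`.
    refine Finset.sum_nbij' (fun k => k ∘ τ) (fun k => k ∘ τ) ?_ ?_ ?_ ?_ ?_
    · intro k hk
      rw [Fintype.mem_piFinset] at hk ⊢
      intro j
      have := hk (τ j)
      rwa [hτ, min_comm] at this
    · intro k hk
      rw [Fintype.mem_piFinset] at hk ⊢
      intro j
      have := hk (τ j)
      rwa [hτ, min_comm] at this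
    · intro k _
      funext j
      simp [hτ j]
    · intro k _
      funext j
      simp [hτ j]
    · intro k _
      have h1 : moyalExponent τ n m k = moyalExponent τ m n (k ∘ τ) := by
        ext j
        simp [moyalExponent, hτ j, add_comm]
      have h2 : moyalCoeff τ n m k = moyalCoeff τ m n (k ∘ τ) := by
        unfold moyalCoeff
        rw [← hτ.bijective.prod_comp]
        refine Finset.prod_congr rfl fun j _ => ?_
        simp only [Function.comp, hτ j]
        ring
      have h3 : ∏ j, c j ^ k j = (-1) ^ (∑ j, (k ∘ τ) j) * ∏ j, c j ^ (k ∘ τ) j := by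
        rw [← Finset.prod_pow_eq_pow_sum, ← Finset.prod_mul_distrib, ← hτ.bijective.prod_comp]
        refine Finset.prod_congr rfl fun j _ => ?_
        rw [hc, ← mul_pow, neg_one_mul, Function.comp]
      rw [h1, h2, h3, mul_assoc]
  rw [h, hW.mul_eq_sum hX hτ hc m n, ← Finset.sum_sub_distrib]
  refine Finset.sum_congr rfl fun k _ => ?_
  rw [← sub_smul]
  congr 1
  ring

end IsWeylFamily

/-! ### Derivatives of moments along lines of states. -/

theorem weylMonomial_isSymmetric {V σ : Type*} [SeminormedAddCommGroup V] [InnerProductSpace ℂ V]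
    {X : σ → Module.End ℂ V} (hX : ∀ i, (X i).IsSymmetric) (m : σ →₀ ℕ) :
    (weylMonomial X m).IsSymmetric :=
  weylProd_isSymmetric _ fun _ => hX _

theorem isWeylFamily_weylMonomial {V σ : Type*} [AddCommGroup V] [Module ℂ V] [Fintype σ]
    [DecidableEq σ] (X : σ → Module.End ℂ V) : IsWeylFamily X (weylMonomial X) :=
  ⟨weylMonomial_zero X, degree_smul_weylMonomial X⟩

/-- The matrix element `⟨u, A v⟩` as a linear function of `A`. -/
def matrixElement {V : Type*} [SeminormedAddCommGroup V] [InnerProductSpace ℂ V] (u v : V) :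
    Module.End ℂ V →ₗ[ℂ] ℂ :=
  (innerₛₗ ℂ u) ∘ₗ LinearMap.applyₗ v

theorem matrixElement_apply {V : Type*} [SeminormedAddCommGroup V] [InnerProductSpace ℂ V]
    (u v : V) (A : Module.End ℂ V) : matrixElement u v A = inner ℂ u (A v) :=
  rfl

/-- The operators may be unbounded, so only matrix elements are differentiated. In the recursion,
symmetry moves `X j` onto the left vector; the induction on the degree must therefore hold for every
`u`. -/
theorem hasDerivAt_matrixElement_weylMonomial {V σ : Type*} [NormedAddCommGroup V]
    [InnerProductSpace ℂ V] [Fintype σ] [DecidableEq σ] {X : σ → Module.End ℂ V}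
    (hX : ∀ i, (X i).IsSymmetric) {l : ℝ → σ → ℂ} {l' : σ → ℂ}
    (hl : ∀ i, HasDerivAt (fun t => l t i) (l' i) 0) (u v : V) (m : σ →₀ ℕ) :
    HasDerivAt (fun t => matrixElement u v (weylMonomial (fun i => X i - l t i • 1) m))
      (-∑ i, l' i * (m i * matrixElement u v
        (weylMonomial (fun i => X i - l 0 i • 1) (m - Finsupp.single i 1)))) 0 := by
  induction hn : m.degree generalizing m u with
  | zero =>
    obtain rfl : m = 0 := by rwa [Finsupp.degree_eq_zero_iff] at hn
    simp only [weylMonomial_zero]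
    simpa using hasDerivAt_const (0 : ℝ) (matrixElement u v 1)
  | succ n ih =>
    have hn0 : (m.degree : ℂ) ≠ 0 := by rw [hn]; exact Nat.cast_ne_zero.mpr n.succ_ne_zero
    have hmul : ∀ (t : ℝ) (i : σ) (B : Module.End ℂ V),
        matrixElement u v ((X i - l t i • 1) * B) =
          matrixElement (X i u) v B - l t i * matrixElement u v B := by
      intro t i B
      simp only [matrixElement_apply, Module.End.mul_apply, LinearMap.sub_apply,
        LinearMap.smul_apply, Module.End.one_apply, inner_sub_right, inner_smul_right, hX i u]
    have hfun : (fun t => matrixElement u v (weylMonomial (fun i => X i - l t i • 1) m)) =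
        fun t => (m.degree : ℂ)⁻¹ * ∑ j, (m j : ℂ) *
          (matrixElement (X j u) v
              (weylMonomial (fun i => X i - l t i • 1) (m - Finsupp.single j 1)) -
            l t j * matrixElement u v
              (weylMonomial (fun i => X i - l t i • 1) (m - Finsupp.single j 1))) := by
      funext t
      have h := congrArg (matrixElement u v)
        ((isWeylFamily_weylMonomial fun i => X i - l t i • 1).degree_smul m)
      simp only [map_smul, map_sum, smul_eq_mul, hmul] at h
      rw [← h, inv_mul_cancel_left₀ hn0]
    rw [hfun]
    set W₀ := weylMonomial fun i => X i - l 0 i • 1 with hW₀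
    have hterm : ∀ j, HasDerivAt (fun t => (m j : ℂ) *
          (matrixElement (X j u) v
              (weylMonomial (fun i => X i - l t i • 1) (m - Finsupp.single j 1)) -
            l t j * matrixElement u v
              (weylMonomial (fun i => X i - l t i • 1) (m - Finsupp.single j 1))))
        (-(l' j * (m j * matrixElement u v (W₀ (m - Finsupp.single j 1)))) -
          ∑ i, l' i * matrixElement u v
            (((m j : ℂ) * ((m - Finsupp.single j 1 : σ →₀ ℕ) i : ℕ)) •
              ((X j - l 0 j • 1) * W₀ (m - Finsupp.single j 1 - Finsupp.single i 1)))) 0 := by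
      intro j
      by_cases hj : m j = 0
      · simpa [hj] using hasDerivAt_const (0 : ℝ) (0 : ℂ)
      have hd : (m - Finsupp.single j 1).degree = n := by
        have := degree_sub_single hj
        omega
      refine ((ih (X j u) _ hd).sub ((hl j).mul (ih u _ hd))).const_mul (m j : ℂ) |>.congr_deriv ?_
      simp only [map_smul, hmul, smul_eq_mul, Finset.mul_sum, mul_sub, mul_add, mul_neg, ← hW₀,
        Finset.sum_sub_distrib]
      have e : ∀ {a b d g f g' : ℂ}, a = d → b = f → g = g' →
          -a - (g + -b) = -g' - (d - f) := by
        rintro a b d g f g' rfl rfl rfl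
        ring
      exact e (Finset.sum_congr rfl fun i _ => by ring) (Finset.sum_congr rfl fun i _ => by ring)
        (by ring)
    refine ((HasDerivAt.fun_sum fun j _ => hterm j).const_mul (m.degree : ℂ)⁻¹).congr_deriv ?_
    rw [inv_mul_eq_iff_eq_mul₀ hn0, Finset.sum_sub_distrib, Finset.sum_comm]
    simp only [← Finset.mul_sum, ← map_sum]
    have hfam : IsWeylFamily (fun i => X i - l 0 i • 1) W₀ := isWeylFamily_weylMonomial _
    have hs := fun i => hfam.sum_mul_sub_single m i
    beta_reduce at hs
    simp only [hs, map_smul, smul_eq_mul, Finset.sum_neg_distrib, Finset.mul_sum, mul_neg]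
    rw [← neg_add', neg_inj, ← Finset.sum_add_distrib]
    exact Finset.sum_congr rfl fun i _ => by ring

theorem hasDerivAt_inner_along_line {V : Type*} [NormedAddCommGroup V] [InnerProductSpace ℂ V]
    {A : ℝ → Module.End ℂ V} (u w : V) {A' : V → V → ℂ}
    (hA : ∀ x y, HasDerivAt (fun t => matrixElement x y (A t)) (A' x y) 0) :
    HasDerivAt (fun t : ℝ => (inner ℂ (u + (t : ℂ) • w) (A t (u + (t : ℂ) • w)) : ℂ))
      (A' u u + (inner ℂ w (A 0 u) + inner ℂ u (A 0 w))) 0 := by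
  have ht : HasDerivAt (fun t : ℝ => (t : ℂ)) 1 0 := Complex.ofRealCLM.hasDerivAt
  have h := ((hA u u).add ((ht.mul (hA w u)).add (ht.mul (hA u w)))).add
    ((ht.mul ht).mul (hA w w))
  refine (h.congr_deriv ?_).congr_of_eventuallyEq (Filter.Eventually.of_forall fun t => ?_)
  · simp [matrixElement_apply]
  · simp only [matrixElement_apply, map_add, map_smul, inner_add_left, inner_add_right,
      inner_smul_left, inner_smul_right, Complex.conj_ofReal, Pi.add_apply, Pi.mul_apply]
    ring

/-! ### The mean commutator of two generators. -/

section commutator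

variable {σ E : Type*} [Fintype σ] [DecidableEq σ] [Ring E] [Algebra ℂ E]

theorem map_commutator_sub_sum (L : E →ₗ[ℂ] ℂ) (hL : L 1 = 1) {x : σ → E} {W : (σ →₀ ℕ) → E}
    {τ : σ → σ} {c : σ → ℂ} (hτ : Function.Involutive τ) (hc : ∀ i, c (τ i) = -c i)
    (hx : ∀ i j, x i * x j - x j * x i = if j = τ i then algebraMap ℂ E (2 * c i) else 0)
    (hW : ∀ i m, x i * W m - W m * x i =
      (2 * c i * (m (τ i) : ℂ)) • W (m - Finsupp.single (τ i) 1))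
    (m n : σ →₀ ℕ) (u v : σ → ℂ) (hu : ∀ i, u i = m i * L (W (m - Finsupp.single i 1)))
    (hv : ∀ i, v i = n i * L (W (n - Finsupp.single i 1))) :
    L ((W m - ∑ i, u i • x i) * (W n - ∑ i, v i • x i) -
        (W n - ∑ i, v i • x i) * (W m - ∑ i, u i • x i)) =
      L (W m * W n - W n * W m) - ∑ i, 2 * c i * (u i * v (τ i)) := by
  have hl : ∀ (w : σ → ℂ) (k : σ →₀ ℕ), L ((∑ i, w i • x i) * W k - W k * ∑ i, w i • x i) =
      ∑ i, 2 * c i * (w i * (k (τ i) * L (W (k - Finsupp.single (τ i) 1)))) := by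
    intro w k
    rw [Finset.sum_mul, Finset.mul_sum, ← Finset.sum_sub_distrib, map_sum]
    refine Finset.sum_congr rfl fun i _ => ?_
    rw [smul_mul_assoc, mul_smul_comm, ← smul_sub, hW, smul_smul, map_smul, smul_eq_mul]
    ring
  have hxx : L ((∑ i, u i • x i) * (∑ i, v i • x i) - (∑ i, v i • x i) * ∑ i, u i • x i) =
      ∑ i, 2 * c i * (u i * v (τ i)) := by
    rw [Finset.sum_mul_sum, Finset.sum_mul_sum, Finset.sum_comm (f := fun i j => v i • x i * u j • x j),
      ← Finset.sum_sub_distrib, map_sum]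
    refine Finset.sum_congr rfl fun i _ => ?_
    rw [← Finset.sum_sub_distrib, map_sum, Finset.sum_eq_single (τ i)]
    · rw [smul_mul_smul_comm, smul_mul_smul_comm, mul_comm (v _), ← smul_sub, hx, if_pos rfl,
        Algebra.algebraMap_eq_smul_one, map_smul, map_smul, hL]
      simp only [smul_eq_mul]
      ring
    · intro j _ hj
      rw [smul_mul_smul_comm, smul_mul_smul_comm, mul_comm (v _), ← smul_sub, hx, if_neg hj]
      simp
    · simp
  have e : (W m - ∑ i, u i • x i) * (W n - ∑ i, v i • x i) -
        (W n - ∑ i, v i • x i) * (W m - ∑ i, u i • x i) =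
      (W m * W n - W n * W m) + ((∑ i, v i • x i) * W m - W m * ∑ i, v i • x i) -
        ((∑ i, u i • x i) * W n - W n * ∑ i, u i • x i) +
        ((∑ i, u i • x i) * (∑ i, v i • x i) - (∑ i, v i • x i) * ∑ i, u i • x i) := by
    noncomm_ring
  -- Reindexing by `τ` identifies the first cross term with minus the common sum. The three
  -- contributions are then `-1`, `-1` and `+1` times this sum.
  have h1 : ∑ i, 2 * c i * (v i * (m (τ i) * L (W (m - Finsupp.single (τ i) 1)))) =
      -∑ i, 2 * c i * (u i * v (τ i)) := by
    rw [← hτ.bijective.sum_comp, ← Finset.sum_neg_distrib]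
    refine Finset.sum_congr rfl fun i _ => ?_
    rw [hτ, ← hu, hc]
    ring
  rw [e, map_add, map_sub, map_add, hl, hl, hxx, h1]
  simp only [← hv]
  ring

end commutator

/-! ### Multi-indices and the canonical operators. -/

/-- The exponents `a` of the positions and `b` of the momenta as one multi-index. -/
def multiIndex {N : ℕ} (a b : Fin N → ℕ) : Fin N ⊕ Fin N →₀ ℕ :=
  Finsupp.equivFunOnFinite.symm (Sum.elim a b)

section multiIndex

variable {N : ℕ} (a b : Fin N → ℕ)

theorem coe_multiIndex : ⇑(multiIndex a b) = Sum.elim a b := rfl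

theorem multiIndex_sub_single_inl (f : Fin N) :
    multiIndex a b - Finsupp.single (Sum.inl f) 1 = multiIndex (Function.update a f (a f - 1)) b := by
  ext (i | i)
  · by_cases h : i = f
    · subst h
      simp [coe_multiIndex]
    · simp [coe_multiIndex, h]
  · simp [coe_multiIndex]

theorem multiIndex_sub_single_inr (f : Fin N) :
    multiIndex a b - Finsupp.single (Sum.inr f) 1 = multiIndex a (Function.update b f (b f - 1)) := by
  ext (i | i)
  · simp [coe_multiIndex]
  · by_cases h : i = f
    · subst h
      simp [coe_multiIndex]
    · simp [coe_multiIndex, h]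

theorem coe_momentWord : (momentWord a b : Multiset (Fin N ⊕ Fin N)) =
    Finsupp.toMultiset (multiIndex a b) := by
  ext (i | i) <;>
  simp [momentWord, Finsupp.count_toMultiset, coe_multiIndex, List.count_flatMap,
    Function.comp_def, List.count_replicate, ← Fin.sum_univ_def]

theorem weylProd_momentWord {V : Type*} [AddCommGroup V] [Module ℂ V]
    (X : Fin N ⊕ Fin N → Module.End ℂ V) :
    weylProd (fun k => X ((momentWord a b).get k)) = weylMonomial X (multiIndex a b) := by
  refine weylProd_eq_weylMonomial X _ (momentWord a b).get ?_
  rw [Fin.univ_val_map, List.ofFn_get, coe_momentWord]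

end multiIndex

/-- Half of the value `[x i, x (swap i)]` of the canonical commutator. -/
def halfCommutator {N : ℕ} (hbar : ℝ) : Fin N ⊕ Fin N → ℂ :=
  Sum.elim (fun _ => Complex.I * hbar / 2) (fun _ => -(Complex.I * hbar / 2))

theorem halfCommutator_swap {N : ℕ} (hbar : ℝ) (i : Fin N ⊕ Fin N) :
    halfCommutator hbar i.swap = -halfCommutator hbar i := by
  rcases i with i | i <;> simp [halfCommutator]

namespace CanonicalOperators

variable {N : ℕ} {hbar : ℝ} {H : Type*} [NormedAddCommGroup H] [InnerProductSpace ℂ H]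
  [CompleteSpace H] (S : CanonicalOperators N hbar H)

theorem x_isSymmetric (i : Fin N ⊕ Fin N) : (S.x i).IsSymmetric := by
  rcases i with i | i
  · exact S.q_symmetric i
  · exact S.p_symmetric i

theorem centered_isSymmetric (Ψ : S.domain) (i : Fin N ⊕ Fin N) :
    (S.centered Ψ i).IsSymmetric := by
  intro u v
  simp only [centered, LinearMap.sub_apply, LinearMap.smul_apply, Module.End.one_apply,
    inner_sub_left, inner_sub_right, inner_smul_left, inner_smul_right, Complex.conj_ofReal,
    S.x_isSymmetric i u v]

theorem x_commutator (i j : Fin N ⊕ Fin N) :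
    S.x i * S.x j - S.x j * S.x i =
      if j = i.swap then algebraMap ℂ _ (2 * halfCommutator hbar i) else 0 := by
  have hq : 2 * (Complex.I * hbar / 2) = Complex.I * hbar := by ring
  have hp : 2 * -(Complex.I * hbar / 2) = -(Complex.I * hbar) := by ring
  rcases i with i | i <;> rcases j with j | j
  · simpa [x] using S.q_comm i j
  · simp only [x, Sum.elim_inl, Sum.elim_inr, Sum.swap_inl, Sum.inr.injEq, halfCommutator, hq,
      Algebra.algebraMap_eq_smul_one, S.q_p_comm, eq_comm]
  · have h := congrArg Neg.neg (S.q_p_comm j i)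
    rw [neg_sub] at h
    simp only [x, Sum.elim_inl, Sum.elim_inr, Sum.swap_inr, Sum.inl.injEq, halfCommutator, hp,
      Algebra.algebraMap_eq_smul_one, h, neg_smul]
    split_ifs <;> simp
  · simpa [x] using S.p_comm i j

theorem centered_eq (Ψ : S.domain) (i : Fin N ⊕ Fin N) :
    S.centered Ψ i = S.x i - algebraMap ℂ _ ((S.mean (S.x i) Ψ : ℝ) : ℂ) := by
  rw [centered, Algebra.algebraMap_eq_smul_one]

theorem centered_commutator (Ψ : S.domain) (i j : Fin N ⊕ Fin N) :
    S.centered Ψ i * S.centered Ψ j - S.centered Ψ j * S.centered Ψ i =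
      if j = i.swap then algebraMap ℂ _ (2 * halfCommutator hbar i) else 0 := by
  rw [← S.x_commutator, centered_eq, centered_eq]
  have h1 := Algebra.commutes ((S.mean (S.x i) Ψ : ℝ) : ℂ) (S.x j)
  have h2 := Algebra.commutes ((S.mean (S.x j) Ψ : ℝ) : ℂ) (S.x i)
  have h3 := Algebra.commutes ((S.mean (S.x i) Ψ : ℝ) : ℂ)
    (algebraMap ℂ (Module.End ℂ S.domain) ((S.mean (S.x j) Ψ : ℝ) : ℂ))
  simp only [mul_sub, sub_mul, h1, h2, h3]
  abel

/-- The Weyl-ordered monomial `x^m` in the centered operators. -/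
def centeredWeyl (Ψ : S.domain) (m : Fin N ⊕ Fin N →₀ ℕ) : Module.End ℂ S.domain :=
  weylMonomial (S.centered Ψ) m

theorem isWeylFamily_centeredWeyl (Ψ : S.domain) :
    IsWeylFamily (S.centered Ψ) (S.centeredWeyl Ψ) :=
  isWeylFamily_weylMonomial _

theorem centeredWeyl_isSymmetric (Ψ : S.domain) (m : Fin N ⊕ Fin N →₀ ℕ) :
    (S.centeredWeyl Ψ m).IsSymmetric :=
  weylMonomial_isSymmetric (S.centered_isSymmetric Ψ) m

theorem x_commutator_centeredWeyl (Ψ : S.domain) (i : Fin N ⊕ Fin N) (m : Fin N ⊕ Fin N →₀ ℕ) :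
    S.x i * S.centeredWeyl Ψ m - S.centeredWeyl Ψ m * S.x i =
      (2 * halfCommutator hbar i * (m i.swap : ℂ)) •
        S.centeredWeyl Ψ (m - Finsupp.single i.swap 1) := by
  rw [← (S.isWeylFamily_centeredWeyl Ψ).commutator (S.centered_commutator Ψ), centered_eq, sub_mul,
    mul_sub, Algebra.commutes]
  abel

/-! ### Hamiltonian vectors of the moments and their symplectic products. -/

/-- The moment `⟨x^m⟩` of the centered operators. -/
def moment (m : Fin N ⊕ Fin N →₀ ℕ) (Ψ : S.domain) : ℝ :=
  S.mean (S.centeredWeyl Ψ m) Ψ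

theorem G_eq_moment (a b : Fin N → ℕ) : S.G a b = S.moment (multiIndex a b) := by
  funext Ψ
  rw [G, moment, centeredMonomial, centeredWeyl, weylProd_momentWord]

theorem matrixElement_centeredWeyl (Ψ : S.domain) (m : Fin N ⊕ Fin N →₀ ℕ) :
    matrixElement Ψ Ψ (S.centeredWeyl Ψ m) = (S.moment m Ψ : ℂ) := by
  refine (Complex.conj_eq_iff_re.mp ?_).symm
  rw [matrixElement_apply, inner_conj_symm]
  exact S.centeredWeyl_isSymmetric Ψ m Ψ Ψ

/-- The operator that generates the Hamiltonian vector of the moment `⟨x^m⟩` at `Ψ`. -/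
def momentGenerator (Ψ : S.domain) (m : Fin N ⊕ Fin N →₀ ℕ) : Module.End ℂ S.domain :=
  S.centeredWeyl Ψ m -
    ∑ i, ((m i : ℂ) * (S.moment (m - Finsupp.single i 1) Ψ : ℂ)) • S.x i

theorem momentGenerator_isSymmetric (Ψ : S.domain) (m : Fin N ⊕ Fin N →₀ ℕ) :
    (S.momentGenerator Ψ m).IsSymmetric := by
  intro u v
  simp only [momentGenerator, LinearMap.sub_apply, LinearMap.sum_apply, LinearMap.smul_apply,
    inner_sub_left, inner_sub_right, sum_inner, inner_sum, inner_smul_left, inner_smul_right,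
    map_mul, Complex.conj_ofReal, Complex.conj_natCast, S.x_isSymmetric _ u v,
    S.centeredWeyl_isSymmetric Ψ m u v]

theorem hasDerivAt_mean_x (Ψ η : S.domain) (i : Fin N ⊕ Fin N) :
    HasDerivAt (fun t : ℝ => S.mean (S.x i) (Ψ + (t : ℂ) • η))
      (2 * (inner ℂ (S.x i Ψ) η : ℂ).re) 0 := by
  have h := hasDerivAt_inner_along_line (A := fun _ => S.x i) Ψ η (A' := fun _ _ => 0)
    (fun _ _ => hasDerivAt_const _ _)
  refine (Complex.reCLM.hasFDerivAt.comp_hasDerivAt 0 h).congr_deriv ?_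
  have h1 := inner_re_symm (𝕜 := ℂ) η (S.x i Ψ)
  have h2 := S.x_isSymmetric i Ψ η
  simp only [RCLike.re_eq_complex_re] at h1
  simp only [zero_add, map_add, Complex.reCLM_apply, ← h2, h1]
  ring

/-- The variation of the two vectors gives `2 Re ⟨W m Ψ, η⟩`. The variation of the centering gives
the linear part of the generator, because the mean of `x i` has derivative `2 Re ⟨x i Ψ, η⟩`. -/
theorem isHamiltonianVector_moment (hh : hbar ≠ 0) (Ψ : S.domain) (m : Fin N ⊕ Fin N →₀ ℕ) :
    IsHamiltonianVector hbar (S.moment m) Ψ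
      ((-Complex.I / hbar) • (S.momentGenerator Ψ m Ψ : H)) := by
  intro η
  have hl : ∀ i, HasDerivAt (fun t : ℝ => ((S.mean (S.x i) (Ψ + (t : ℂ) • η) : ℝ) : ℂ))
      ((2 * (inner ℂ (S.x i Ψ) η : ℂ).re : ℝ) : ℂ) 0 :=
    fun i => (S.hasDerivAt_mean_x Ψ η i).ofReal_comp
  have h := hasDerivAt_inner_along_line Ψ η
    (fun u v => hasDerivAt_matrixElement_weylMonomial S.x_isSymmetric hl u v m)
  refine (Complex.reCLM.hasFDerivAt.comp_hasDerivAt 0 h).congr_deriv ?_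
  have h0 : (fun i => S.x i - ((S.mean (S.x i) (Ψ + ((0 : ℝ) : ℂ) • η) : ℝ) : ℂ) • 1) =
      S.centered Ψ := by
    funext i
    simp [centered]
  rw [h0]
  change Complex.re (-∑ i, _ * (_ * matrixElement Ψ Ψ (S.centeredWeyl Ψ _)) +
    (inner ℂ η (S.centeredWeyl Ψ m Ψ) + inner ℂ Ψ (S.centeredWeyl Ψ m η))) = _
  have h1 := inner_re_symm (𝕜 := ℂ) η (S.centeredWeyl Ψ m Ψ)
  simp only [RCLike.re_eq_complex_re] at h1
  have h3 : sympForm hbar ((-Complex.I / hbar) • (S.momentGenerator Ψ m Ψ : H)) (η : H) =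
      2 * (inner ℂ (S.momentGenerator Ψ m Ψ) η : ℂ).re := by
    have hconj : (starRingEnd ℂ) (-Complex.I / hbar) = ((hbar⁻¹ : ℝ) : ℂ) * Complex.I := by
      simp [div_eq_mul_inv, mul_comm]
    rw [sympForm, inner_smul_left, hconj, mul_assoc (Complex.ofReal _), Complex.im_ofReal_mul, Complex.I_mul_im,
      Submodule.coe_inner]
    field_simp
  rw [h3, momentGenerator]
  simp only [LinearMap.sub_apply, LinearMap.sum_apply, LinearMap.smul_apply, inner_sub_left,
    sum_inner, inner_smul_left, map_mul, Complex.conj_ofReal, Complex.conj_natCast,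
    matrixElement_centeredWeyl, ← S.centeredWeyl_isSymmetric Ψ m Ψ η, Complex.add_re,
    Complex.sub_re, Complex.neg_re, h1, Complex.re_sum]
  simp only [← Complex.ofReal_natCast, ← Complex.ofReal_mul, Complex.ofReal_re,
    Complex.re_ofReal_mul]
  rw [mul_sub, Finset.mul_sum]
  have : ∀ {a b d : ℝ}, a = b → -a + (d + d) = 2 * d - b := by
    rintro a b d rfl
    ring
  exact this (Finset.sum_congr rfl fun i _ => by ring)

/-- For symmetric `A` and `B`, `⟨[A, B]⟩` is `2i Im ⟨AΨ, BΨ⟩`, and the two prefactors `-i/ħ`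
contribute `1/ħ²`. -/
theorem sympForm_momentGenerator (hh : hbar ≠ 0) (Ψ : S.domain) (m n : Fin N ⊕ Fin N →₀ ℕ) :
    ((sympForm hbar ((-Complex.I / hbar) • (S.momentGenerator Ψ m Ψ : H))
        ((-Complex.I / hbar) • (S.momentGenerator Ψ n Ψ : H)) : ℝ) : ℂ) =
      (Complex.I * hbar)⁻¹ * matrixElement Ψ Ψ
        (S.momentGenerator Ψ m * S.momentGenerator Ψ n -
          S.momentGenerator Ψ n * S.momentGenerator Ψ m) := by
  have h : matrixElement Ψ Ψ (S.momentGenerator Ψ m * S.momentGenerator Ψ n -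
      S.momentGenerator Ψ n * S.momentGenerator Ψ m) =
      2 * Complex.I * ((inner ℂ (S.momentGenerator Ψ m Ψ) (S.momentGenerator Ψ n Ψ) : ℂ).im : ℂ) := by
    rw [map_sub, matrixElement_apply, matrixElement_apply, Module.End.mul_apply,
      Module.End.mul_apply, ← S.momentGenerator_isSymmetric Ψ m Ψ,
      ← S.momentGenerator_isSymmetric Ψ n Ψ, ← inner_conj_symm (S.momentGenerator Ψ n Ψ)]
    rw [Complex.sub_conj]
    push_cast
    ring
  have hc : (hbar : ℂ) ≠ 0 := Complex.ofReal_ne_zero.mpr hh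
  have hn : (starRingEnd ℂ) (-Complex.I / hbar) * (-Complex.I / hbar) = (((hbar ^ 2)⁻¹ : ℝ) : ℂ) := by
    simp only [map_div₀, map_neg, Complex.conj_I, Complex.conj_ofReal, neg_neg]
    push_cast
    field_simp
    simp
  rw [h, sympForm, inner_smul_left, inner_smul_right, ← mul_assoc, hn, Complex.im_ofReal_mul]
  simp only [Submodule.coe_inner]
  push_cast
  field_simp

theorem matrixElement_commutator_momentGenerator (Ψ : S.domain) (hΨ : ‖Ψ‖ = 1)
    (m n : Fin N ⊕ Fin N →₀ ℕ) :
    matrixElement Ψ Ψ (S.momentGenerator Ψ m * S.momentGenerator Ψ n -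
        S.momentGenerator Ψ n * S.momentGenerator Ψ m) =
      ∑ k ∈ Fintype.piFinset fun j => Finset.range (min (m j) (n j.swap) + 1),
        ((1 - (-1) ^ (∑ j, k j)) * ((∏ j, halfCommutator hbar j ^ k j) *
          (moyalCoeff Sum.swap m n k : ℂ))) * (S.moment (moyalExponent Sum.swap m n k) Ψ : ℂ) -
      ∑ i, 2 * halfCommutator hbar i *
        (((m i : ℂ) * (S.moment (m - Finsupp.single i 1) Ψ : ℂ)) *
          ((n i.swap : ℂ) * (S.moment (n - Finsupp.single i.swap 1) Ψ : ℂ))) := by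
  have hτ : Function.Involutive (Sum.swap : Fin N ⊕ Fin N → Fin N ⊕ Fin N) := Sum.swap_swap
  have h1 : matrixElement Ψ Ψ (1 : Module.End ℂ S.domain) = 1 := by
    rw [matrixElement_apply, Module.End.one_apply, inner_self_eq_norm_sq_to_K, hΨ]
    simp
  rw [momentGenerator, momentGenerator, map_commutator_sub_sum (matrixElement Ψ Ψ) h1 hτ
    (halfCommutator_swap hbar) S.x_commutator (S.x_commutator_centeredWeyl Ψ) m n
    (fun i => (m i : ℂ) * (S.moment (m - Finsupp.single i 1) Ψ : ℂ))
    (fun i => (n i : ℂ) * (S.moment (n - Finsupp.single i 1) Ψ : ℂ))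
    (fun i => by rw [matrixElement_centeredWeyl]) (fun i => by rw [matrixElement_centeredWeyl]),
    (S.isWeylFamily_centeredWeyl Ψ).commutator_eq_sum (S.centered_commutator Ψ) hτ
      (halfCommutator_swap hbar)]
  simp only [map_sum, map_smul, matrixElement_centeredWeyl, smul_eq_mul]

end CanonicalOperators

/-! ### Resummation of the odd contractions. -/

/-- Contraction patterns with an odd number of contractions, sorted by their number `2 * r + 1`, by
the number `s` of contractions of positions on the left, and by the total numbers `e f` of
contractions in the degrees of freedom `f`. -/
theorem sum_odd_contractions {N : ℕ} {M : Type*} [AddCommMonoid M] (a b c d : Fin N → ℕ)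
    (T : ℕ → ℕ → (Fin N → ℕ) → (Fin N → ℕ) → M) :
    ∑ k ∈ (Fintype.piFinset fun j : Fin N ⊕ Fin N =>
        Finset.range (min (Sum.elim a b j) (Sum.elim c d j.swap) + 1)) with Odd (∑ j, k j),
      T ((∑ j, k j) / 2) (∑ f, k (Sum.inl f)) (fun f => k (Sum.inl f) + k (Sum.inr f))
        (fun f => k (Sum.inr f)) =
    ∑ r ∈ Finset.range (∑ f, (min (a f) (d f) + min (b f) (c f))) with
        2 * r + 1 ≤ ∑ f, (min (a f) (d f) + min (b f) (c f)),
      ∑ s ∈ Finset.Icc 0 (min (2 * r + 1) (∑ f, min (a f) (d f))),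
      ∑ e ∈ (Fintype.piFinset fun f => Finset.Icc 0
          (min (a f) (min (d f) s) + min (b f) (min (c f) (2 * r + 1 - s)))) with
          ∑ f, e f = 2 * r + 1,
      ∑ g ∈ (Fintype.piFinset fun f =>
          Finset.Icc (max (e f - s) (max (e f - a f) (e f - d f)))
            (min (b f) (min (c f) (min (2 * r + 1 - s) (e f))))) with
          ∑ f, g f = 2 * r + 1 - s,
        T r s e g := by
  simp only [Finset.sum_sigma']
  refine Finset.sum_bij'
    (fun k _ => ⟨(∑ j, k j) / 2, ∑ f, k (Sum.inl f), fun f => k (Sum.inl f) + k (Sum.inr f),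
      fun f => k (Sum.inr f)⟩)
    (fun z _ => Sum.elim (fun f => z.2.2.1 f - z.2.2.2 f) z.2.2.2) ?_ ?_ ?_ ?_ ?_
  · intro k hk
    simp only [Finset.mem_filter, Fintype.mem_piFinset, Finset.mem_range, Nat.lt_succ_iff,
      Sum.forall, Sum.elim_inl, Sum.elim_inr, Sum.swap_inl, Sum.swap_inr, le_min_iff] at hk
    obtain ⟨⟨hh, hg⟩, r, hr⟩ := hk
    have hr2 : (∑ j, k j) / 2 = r := by omega
    have hs : ∑ f, k (Sum.inl f) + ∑ f, k (Sum.inr f) = 2 * r + 1 := by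
      rw [← hr, Fintype.sum_sum_type]
    have hsl : ∑ f, k (Sum.inl f) ≤ ∑ f, min (a f) (d f) :=
      Finset.sum_le_sum fun f _ => le_min (hh f).1 (hh f).2
    have hsr : ∑ f, k (Sum.inr f) ≤ ∑ f, min (b f) (c f) :=
      Finset.sum_le_sum fun f _ => le_min (hg f).1 (hg f).2
    have hl : ∀ f, k (Sum.inl f) ≤ ∑ f, k (Sum.inl f) := fun f =>
      Finset.single_le_sum (f := fun f => k (Sum.inl f)) (fun _ _ => Nat.zero_le _)
        (Finset.mem_univ f)
    have hl' : ∀ f, k (Sum.inr f) ≤ ∑ f, k (Sum.inr f) := fun f =>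
      Finset.single_le_sum (f := fun f => k (Sum.inr f)) (fun _ _ => Nat.zero_le _)
        (Finset.mem_univ f)
    simp only [Finset.mem_sigma, Finset.mem_filter, Finset.mem_range, Fintype.mem_piFinset,
      Finset.mem_Icc, hr2, Finset.sum_add_distrib]
    -- The range of `r` only makes the sum finite: `2 * r + 1 ≤ M` already forces `r < M`.
    refine ⟨⟨by omega, by omega⟩, ⟨by omega, by omega⟩, ⟨fun f => ?_, hs⟩, fun f => ?_, by omega⟩
    · have := hh f
      have := hg f
      have := hl f
      have := hl' f
      omega
    · have := hh f
      have := hg f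
      have := hl f
      have := hl' f
      omega
  · rintro ⟨r, s, e, g⟩ hz
    simp only [Finset.mem_sigma, Finset.mem_filter, Finset.mem_range, Fintype.mem_piFinset,
      Finset.mem_Icc] at hz
    obtain ⟨-, hs, ⟨-, he⟩, hg, hgs⟩ := hz
    simp only [Finset.mem_filter, Fintype.mem_piFinset, Finset.mem_range, Nat.lt_succ_iff,
      Sum.forall, Sum.elim_inl, Sum.elim_inr, Sum.swap_inl, Sum.swap_inr, Fintype.sum_sum_type]
    refine ⟨⟨fun f => ?_, fun f => ?_⟩, r, ?_⟩
    · have := hg f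
      omega
    · have := hg f
      omega
    · rw [← Finset.sum_add_distrib, ← he]
      refine Finset.sum_congr rfl fun f _ => ?_
      have := hg f
      omega
  · intro k _
    funext j
    rcases j with f | f <;> simp
  · rintro ⟨r, s, e, g⟩ hz
    simp only [Finset.mem_sigma, Finset.mem_filter, Finset.mem_range, Fintype.mem_piFinset,
      Finset.mem_Icc] at hz
    obtain ⟨-, hs, ⟨-, he⟩, hg, hgs⟩ := hz
    have h1 : (fun f => e f - g f + g f) = e := by
      funext f
      have := hg f
      omega
    have h2 : ∑ f, (e f - g f) + ∑ f, g f = 2 * r + 1 := by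
      rw [← Finset.sum_add_distrib, ← he, h1]
    have h3 : ∑ f, (e f - g f) = s := by omega
    have h4 : (s + ∑ f, g f) / 2 = r := by omega
    simp only [Fintype.sum_sum_type, Sum.elim_inl, Sum.elim_inr, h1, h3, h4]
  · intro k _
    rfl

theorem prod_halfCommutator_pow {N : ℕ} (hbar : ℝ) (k : Fin N ⊕ Fin N → ℕ) :
    ∏ j, halfCommutator hbar j ^ k j =
      (-1) ^ (∑ f, k (Sum.inr f)) * (Complex.I * hbar / 2) ^ (∑ j, k j) := by
  rw [Fintype.prod_sum_type, Fintype.sum_sum_type]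
  simp only [halfCommutator, Sum.elim_inl, Sum.elim_inr, Finset.prod_pow_eq_pow_sum]
  rw [neg_pow, pow_add]
  ring

/-- For `2r + 1` contractions, `2 (iħ/2)^(2r+1) / (iħ)` is `(-1)^r (ħ/2)^(2r)`. The momentum letters
on the left contribute `(-1)^(2r+1-s) = -(-1)^s`. -/
theorem moyal_term_eq {N : ℕ} {hbar : ℝ} (hh : hbar ≠ 0) (k : Fin N ⊕ Fin N → ℕ)
    (hk : Odd (∑ j, k j)) :
    (Complex.I * hbar)⁻¹ * ((1 - (-1) ^ (∑ j, k j)) * ∏ j, halfCommutator hbar j ^ k j) =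
      -((-1) ^ ((∑ j, k j) / 2 + ∑ f, k (Sum.inl f)) *
        ((hbar : ℂ) / 2) ^ (2 * ((∑ j, k j) / 2))) := by
  rw [prod_halfCommutator_pow, hk.neg_one_pow]
  have hc : (hbar : ℂ) ≠ 0 := Complex.ofReal_ne_zero.mpr hh
  have hsum := Fintype.sum_sum_type k
  have hsign : (-1 : ℂ) ^ (∑ f, k (Sum.inr f)) = -(-1) ^ (∑ f, k (Sum.inl f)) := by
    have h := hk.neg_one_pow (α := ℂ)
    rw [hsum, pow_add] at h
    have h2 : ((-1 : ℂ) ^ (∑ f, k (Sum.inl f))) ^ 2 = 1 := by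
      rw [← pow_mul, mul_comm, pow_mul]
      simp
    linear_combination (-1) ^ (∑ f, k (Sum.inl f)) * h - (-1) ^ (∑ f, k (Sum.inr f)) * h2
  obtain ⟨r, hr⟩ := hk
  have hr2 : (∑ j, k j) / 2 = r := by omega
  rw [hsign, hr2, hr, pow_succ, pow_mul (Complex.I * hbar / 2),
    show (Complex.I * (hbar : ℂ) / 2) ^ 2 = -1 * ((hbar : ℂ) / 2) ^ 2 by
      rw [mul_div_assoc, mul_pow, Complex.I_sq], mul_pow, ← pow_mul, pow_add]
  have hI := Complex.I_ne_zero
  field_simp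
  ring

/-- The bounds on `k` allow the two truncated subtractions to be merged into one. -/
theorem moyalExponent_swap {N : ℕ} {a b c d : Fin N → ℕ} {k : Fin N ⊕ Fin N → ℕ}
    (hk : ∀ j, k j ≤ min (Sum.elim a b j) (Sum.elim c d j.swap)) :
    moyalExponent Sum.swap (Sum.elim a b) (Sum.elim c d) k =
      multiIndex (fun f => a f + c f - (k (Sum.inl f) + k (Sum.inr f)))
        (fun f => b f + d f - (k (Sum.inl f) + k (Sum.inr f))) := by
  ext (f | f)
  all_goals
    have h1 := hk (Sum.inl f)
    have h2 := hk (Sum.inr f)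
    simp only [Sum.elim_inl, Sum.elim_inr, Sum.swap_inl, Sum.swap_inr] at h1 h2
    simp only [moyalExponent, multiIndex, Finsupp.equivFunOnFinite_symm_apply_apply, Sum.elim_inl,
      Sum.elim_inr, Sum.swap_inl, Sum.swap_inr]
    omega

theorem moyalCoeff_swap {N : ℕ} (a b c d : Fin N → ℕ) (k : Fin N ⊕ Fin N → ℕ) :
    moyalCoeff Sum.swap (Sum.elim a b) (Sum.elim c d) k =
      ∏ f, (k (Sum.inr f))! * (k (Sum.inl f) + k (Sum.inr f) - k (Sum.inr f))! *
        ((a f).choose (k (Sum.inl f) + k (Sum.inr f) - k (Sum.inr f)) *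
          (b f).choose (k (Sum.inr f)) * (c f).choose (k (Sum.inr f)) *
          (d f).choose (k (Sum.inl f) + k (Sum.inr f) - k (Sum.inr f))) := by
  rw [moyalCoeff, Fintype.prod_sum_type, ← Finset.prod_mul_distrib]
  refine Finset.prod_congr rfl fun f _ => ?_
  simp only [Sum.elim_inl, Sum.elim_inr, Sum.swap_inl, Sum.swap_inr, Nat.add_sub_cancel]
  ring

theorem moyal_sum_eq {N : ℕ} {hbar : ℝ} (hh : hbar ≠ 0) (a b c d : Fin N → ℕ)
    (Γ : (Fin N ⊕ Fin N →₀ ℕ) → ℝ) :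
    (Complex.I * hbar)⁻¹ * ∑ k ∈ Fintype.piFinset fun j : Fin N ⊕ Fin N =>
        Finset.range (min (Sum.elim a b j) (Sum.elim c d j.swap) + 1),
      ((1 - (-1) ^ (∑ j, k j)) * ((∏ j, halfCommutator hbar j ^ k j) *
        (moyalCoeff Sum.swap (Sum.elim a b) (Sum.elim c d) k : ℂ))) *
          (Γ (moyalExponent Sum.swap (Sum.elim a b) (Sum.elim c d) k) : ℂ) =
    ((-∑ r ∈ Finset.range (∑ f, (min (a f) (d f) + min (b f) (c f))) with
          2 * r + 1 ≤ ∑ f, (min (a f) (d f) + min (b f) (c f)),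
        ∑ s ∈ Finset.Icc 0 (min (2 * r + 1) (∑ f, min (a f) (d f))),
        ∑ e ∈ (Fintype.piFinset fun f => Finset.Icc 0
            (min (a f) (min (d f) s) + min (b f) (min (c f) (2 * r + 1 - s)))) with
            ∑ f, e f = 2 * r + 1,
          (-1 : ℝ) ^ (r + s) * (hbar / 2) ^ (2 * r) * (bracketCoeff a b c d r s e : ℝ) *
            Γ (multiIndex (fun f => a f + c f - e f) (fun f => b f + d f - e f)) : ℝ) : ℂ) := by
  simp only [bracketCoeff, Nat.cast_sum, Finset.mul_sum, Finset.sum_mul]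
  rw [← sum_odd_contractions a b c d (fun r s e g => (-1 : ℝ) ^ (r + s) * (hbar / 2) ^ (2 * r) *
    ((∏ f, (g f)! * (e f - g f)! * ((a f).choose (e f - g f) * (b f).choose (g f) *
      (c f).choose (g f) * (d f).choose (e f - g f)) : ℕ) : ℝ) *
    Γ (multiIndex (fun f => a f + c f - e f) (fun f => b f + d f - e f))),
    Finset.sum_filter, ← Finset.sum_neg_distrib, Complex.ofReal_sum]
  refine Finset.sum_congr rfl fun k hk => ?_
  split_ifs with hodd
  · simp only [Fintype.mem_piFinset, Finset.mem_range, Nat.lt_succ_iff] at hk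
    rw [moyalExponent_swap hk, ← moyalCoeff_swap]
    have h := moyal_term_eq hh k hodd
    push_cast
    linear_combination (moyalCoeff Sum.swap (Sum.elim a b) (Sum.elim c d) k : ℂ) *
      (Γ (multiIndex (fun f => a f + c f - (k (Sum.inl f) + k (Sum.inr f)))
        (fun f => b f + d f - (k (Sum.inl f) + k (Sum.inr f)))) : ℂ) * h
  · rw [(Nat.not_odd_iff_even.mp hodd).neg_one_pow]
    simp

end

theorem lemma4 {N : ℕ} {hbar : ℝ} (hh : 0 < hbar) {H : Type*} [NormedAddCommGroup H]
    [InnerProductSpace ℂ H] [CompleteSpace H] (S : CanonicalOperators N hbar H)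
    (a b c d : Fin N → ℕ) (Ψ : S.domain) (hΨ : ‖Ψ‖ = 1) :
    HasPoissonBracketAt hbar (S.G a b) (S.G c d) Ψ
      (-(∑ r ∈ Finset.range (∑ f, (min (a f) (d f) + min (b f) (c f))) with
            2 * r + 1 ≤ ∑ f, (min (a f) (d f) + min (b f) (c f)),
          ∑ s ∈ Finset.Icc 0 (min (2 * r + 1) (∑ f, min (a f) (d f))),
          ∑ e ∈ (Fintype.piFinset fun f => Finset.Icc 0
              (min (a f) (min (d f) s) + min (b f) (min (c f) (2 * r + 1 - s)))) with
              ∑ f, e f = 2 * r + 1,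
            (-1 : ℝ) ^ (r + s) * (hbar / 2) ^ (2 * r) * (bracketCoeff a b c d r s e : ℝ) *
              S.G (fun f => a f + c f - e f) (fun f => b f + d f - e f) Ψ)
        - ∑ f,
          ((a f : ℝ) * (d f : ℝ) *
              S.G (Function.update a f (a f - 1)) b Ψ * S.G c (Function.update d f (d f - 1)) Ψ
            - (b f : ℝ) * (c f : ℝ) *
              S.G a (Function.update b f (b f - 1)) Ψ *
                S.G (Function.update c f (c f - 1)) d Ψ)) := by
  simp only [S.G_eq_moment]
  refine ⟨_, _, S.isHamiltonianVector_moment hh.ne' Ψ _, S.isHamiltonianVector_moment hh.ne' Ψ _, ?_⟩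
  apply Complex.ofReal_injective
  rw [S.sympForm_momentGenerator hh.ne', S.matrixElement_commutator_momentGenerator Ψ hΨ, mul_sub]
  simp only [coe_multiIndex]
  rw [moyal_sum_eq hh.ne' a b c d (fun m => S.moment m Ψ), Complex.ofReal_sub]
  congr 1
  have hc : (hbar : ℂ) ≠ 0 := Complex.ofReal_ne_zero.mpr hh.ne'
  have hI := Complex.I_ne_zero
  rw [Fintype.sum_sum_type, Finset.sum_sub_distrib, Complex.ofReal_sub, Complex.ofReal_sum,
    Complex.ofReal_sum, mul_add, Finset.mul_sum, Finset.mul_sum, sub_eq_add_neg,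
    ← Finset.sum_neg_distrib]
  -- Here `2 c_i / (iħ)` is `1` for positions and `-1` for momenta. Truncation of `a f - 1` at `a f
  -- = 0` is harmless because of the prefactor.
  congr 1 <;> refine Finset.sum_congr rfl fun f _ => ?_
  all_goals
    simp only [halfCommutator, Sum.elim_inl, Sum.elim_inr, Sum.swap_inl, Sum.swap_inr,
      multiIndex_sub_single_inl, multiIndex_sub_single_inr]
    push_cast
    field_simp
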